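/- **Setting.** Let $N_s\ge 1$ and $d,k\ge 0$ be integers and, for $i\in\{1,\dots,N_s\}$, let $A_i\in\mathbb R^{d\times d}$, $B_i\in\mathbb R^{d\times k}$, $Q_i\in\mathbb R^{d\times d}$ and $R_i\in\mathbb R^{k\times k}$ with $Q_i\succ0$, $R_i\succ 0$. Let $(\omega(t))_{t\ge0}$ be a Markov chain on $\{1,\dots,N_s\}$ with transition matrix $(p_{ij})$ and initial distribution $\pi$, all $\pi_i>0$, and let $x_0\in\mathbb R^d$ be a square-integrable random vector independent of the chain with $\mathbb E[x_0x_0^\top]\succ0$. A policy is a tuple $K=(K_1,\dots,K_{N_s})$ with $K_i\in\mathbb R^{k\times d}$; it generates $x_{t+1}=A_{\omega(t)}x_t+B_{\omega(t)}u_t$ with $u_t=-K_{\omega(t)}x_t$ and has cost $$C(K)=\mathbb E\Big[\sum_{t=0}^\infty x_t^\top Q_{\omega(t)}x_t+u_t^\top R_{\omega(t)}u_t\Big]\in[0,\infty].$$ For a matrix $M$, $\|M\|$ is the largest singular value and, for square $M$, $\sigma_{\min}(M)$ is the smallest one; for a tuple, $\|V\|=\max_i\|V_i\|$ and $\Lambda_{\min}(V)=\min_i\sigma_{\min}(V_i)$.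 Put $\mu=(\min_i\pi_i)\,\sigma_{\min}(\mathbb E[x_0x_0^\top])$. **Lemma.** Let $K$ be a policy with $C(K)<\infty$ and let $K'$ be a policy with $$\|K'-K\|\le\min\Big(\frac{\Lambda_{\min}(Q)\,\mu}{4\,C(K)\sum_{i}\|B_i\|\,(\|A_i-B_iK_i\|+1)},\ \sum_{i}\|K_i\|\Big),$$ where the first bound is read as $+\infty$ if its denominator is $0$. Then $C(K')<\infty$ and $$|C(K')-C(K)|\le c_{\rm diff}\,\|K'-K\|,$$ where $c_{\rm diff}$ depends only on $\|A\|,\|B\|,\|Q\|,\|R\|$, $\kappa=\sum_i\|K_i\|$, $\rho=C(K)/\Lambda_{\min}(Q)$ and $\mu$, namely $$c_{\rm diff}=2\rho\Big(3\Big(\|R\|+\|B\|^2\,\frac{\rho\,\|Q\|}{\mu}\Big)\kappa+2\,\|A\|\,\|B\|\,\frac{\rho\,\|Q\|}{\mu}\Big).$$ -/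

import Mathlib

open MeasureTheory ProbabilityTheory
open scoped Matrix Matrix.Norms.L2Operator

/- Matrices carry the operator norm for Euclidean vectors (the maximal singular value).  A tuple
`V : Fin N → Matrix _ _ ℝ` then carries Mathlib's sup norm `‖V‖ = max_i ‖V i‖`. -/

/-- The data of a Markovian jump LQR problem with `Ns` modes, state dimension `d` and control
dimension `k`, with the standing assumptions on them: `Q ≻ 0`, `R ≻ 0`, `p` is a transition
probability matrix and `ini` is a probability vector with positive entries. -/
structure MJLS (Ns d k : ℕ) where
  A : Fin Ns → Matrix (Fin d) (Fin d) ℝ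
  B : Fin Ns → Matrix (Fin d) (Fin k) ℝ
  Q : Fin Ns → Matrix (Fin d) (Fin d) ℝ
  R : Fin Ns → Matrix (Fin k) (Fin k) ℝ
  p : Fin Ns → Fin Ns → ℝ
  ini : Fin Ns → ℝ
  Q_posDef : ∀ i, (Q i).PosDef
  R_posDef : ∀ i, (R i).PosDef
  p_nonneg : ∀ i j, 0 ≤ p i j
  p_sum : ∀ i, ∑ j, p i j = 1
  ini_pos : ∀ i, 0 < ini i
  ini_sum : ∑ i, ini i = 1

/-- The matrix `E[x₀ x₀ᵀ]` of second moments. -/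
noncomputable def secondMoment {Ω : Type*} [MeasurableSpace Ω] (Pr : Measure Ω) {d : ℕ}
    (x₀ : Ω → Fin d → ℝ) : Matrix (Fin d) (Fin d) ℝ :=
  Matrix.of fun a b => ∫ w, x₀ w a * x₀ w b ∂Pr

/-- The smallest singular value of a square matrix (Mathlib lists the singular values in
decreasing order, so it is the one with index `d - 1`). -/
noncomputable def sigmaMin {d : ℕ} (M : Matrix (Fin d) (Fin d) ℝ) : ℝ :=
  (Matrix.toEuclideanLin M).singularValues (d - 1)

/-- `Λ_min(V) = min_i σ_min(V_i)`. -/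
noncomputable def lambdaMin {Ns d : ℕ} (V : Fin Ns → Matrix (Fin d) (Fin d) ℝ) : ℝ :=
  ⨅ i, sigmaMin (V i)

namespace MJLS

variable {Ns d k : ℕ}

/-- The control `u = -K_i x` of the linear feedback `K` in mode `i` and state `x`. -/
def control (K : Fin Ns → Matrix (Fin k) (Fin d) ℝ) (i : Fin Ns) (x : Fin d → ℝ) : Fin k → ℝ :=
  -(K i *ᵥ x)

/-- The trajectory `x_{t+1} = A_{ω(t)} x_t + B_{ω(t)} u_t`, with `u_t = -K_{ω(t)} x_t`, along a mode
sequence `ω` and from an initial state `x`. -/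
def state (S : MJLS Ns d k) (K : Fin Ns → Matrix (Fin k) (Fin d) ℝ)
    (x : Fin d → ℝ) (ω : ℕ → Fin Ns) : ℕ → Fin d → ℝ
  | 0 => x
  | t + 1 => S.A (ω t) *ᵥ state S K x ω t + S.B (ω t) *ᵥ control K (ω t) (state S K x ω t)

/-- The running cost `xᵀ Q_i x + uᵀ R_i u`. -/
def stageCost (S : MJLS Ns d k) (i : Fin Ns) (x : Fin d → ℝ) (u : Fin k → ℝ) : ℝ :=
  x ⬝ᵥ (S.Q i *ᵥ x) + u ⬝ᵥ (S.R i *ᵥ u)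

/-- The initial state `x₀` and the mode process `ω` on the probability space `(Ω, Pr)` drive the
system `S`: `ω` is a Markov chain with initial distribution `S.ini` and transition probabilities
`S.p` (given through its finite-dimensional distributions), `x₀` is independent of the chain, is
square integrable and has a positive definite second moment matrix. -/
structure IsDrivenBy (S : MJLS Ns d k) {Ω : Type*} [MeasurableSpace Ω] (Pr : Measure Ω)
    (x₀ : Ω → Fin d → ℝ) (ω : Ω → ℕ → Fin Ns) : Prop where
  measurable_state : Measurable x₀
  measurable_mode : Measurable ω
  memLp : MemLp x₀ 2 Pr
  posDef : (secondMoment Pr x₀).PosDef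
  indep : IndepFun x₀ ω Pr
  markov : ∀ (t : ℕ) (i : ℕ → Fin Ns), Pr {w | ∀ s ≤ t, ω w s = i s} =
    ENNReal.ofReal (S.ini (i 0) * ∏ s ∈ Finset.range t, S.p (i s) (i (s + 1)))

/-- The cost `C(K) = E[∑_{t ≥ 0} x_tᵀ Q_{ω(t)} x_t + u_tᵀ R_{ω(t)} u_t]` of the feedback `K`, a
number in `[0, ∞]`. -/
noncomputable def cost (S : MJLS Ns d k) {Ω : Type*} [MeasurableSpace Ω] (Pr : Measure Ω)
    (x₀ : Ω → Fin d → ℝ) (ω : Ω → ℕ → Fin Ns) (K : Fin Ns → Matrix (Fin k) (Fin d) ℝ) :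
    ENNReal :=
  ∫⁻ w, ∑' t, ENNReal.ofReal
    (S.stageCost (ω w t) (S.state K (x₀ w) (ω w) t)
      (control K (ω w t) (S.state K (x₀ w) (ω w) t))) ∂Pr

/-- `μ = (min_i π_i) σ_min(E[x₀ x₀ᵀ])`. -/
noncomputable def excitation (S : MJLS Ns d k) {Ω : Type*} [MeasurableSpace Ω] (Pr : Measure Ω)
    (x₀ : Ω → Fin d → ℝ) : ℝ :=
  (⨅ i, S.ini i) * sigmaMin (secondMoment Pr x₀)

end MJLS

/-- The Lipschitz constant as a function of `a = ‖A‖`, `b = ‖B‖`, `q = ‖Q‖`, `r = ‖R‖` (maximum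
norms of tuples), `κ = ∑ i, ‖K_i‖`, `ρ = C(K) / Λ_min(Q)` and `m = μ`. -/
noncomputable def cDiff (a b q r κ ρ m : ℝ) : ℝ :=
  2 * ρ * (3 * (r + b ^ 2 * (ρ * q / m)) * κ + 2 * a * b * (ρ * q / m))

/-! Let `P n` be the matrices of the `n`-step cost of `K`, so `P (n+1) = W + T_K (P n)` with `W` the
stage matrices and `T_K` the operator `backward`. Conditioning on the chain shows that `C(K)` is the
supremum of the means of the `P n`, so everything can be proved at a finite horizon with bounds
uniform in `n`; no infinite-horizon value matrix is needed.

Since every mode has positive initial probability and `E[x₀ x₀ᵀ]` is positive definite, the mean of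
a positive semidefinite family controls its norm (`excitation_mul_norm_le`): `‖P n i‖ ≤ C(K)/μ`.
Replacing `K` by `K'` therefore changes `T_K (P n)` by at most a multiple of `C(K)/μ`, and the
radius condition makes this at most `Λ/2` times the energy `|x|²`, where `Λ = Λ_min(Q)`. As `W`
dominates `Λ |x|²`, half of the decrease survives: `P n` is a Lyapunov function for `K'`, and the
mean energy of the trajectories of `K'` is at most `2 C(K)/Λ = 2ρ` (`smul_valueIter_one_le`).

Finally `P' (n+1) - P (n+1) = T_K' (P' n - P n) + D n`, where `D n` is the one-step effect of the
policy change on `P n`. Since `D n` is at most `c |x|²`, with `c` proportional to `‖K' - K‖`, the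
two costs differ by at most `c` times the energy of `K'`, that is by `2ρc`
(`neg_smul_valueIter_one_le_of_step`). -/

/-! ### Euclidean norms, quadratic forms and smallest singular values -/

/-- The Euclidean norm of a coordinate vector. -/
noncomputable def euclNorm {n : ℕ} (x : Fin n → ℝ) : ℝ := ‖WithLp.toLp 2 x‖

lemma euclNorm_nonneg {n : ℕ} (x : Fin n → ℝ) : 0 ≤ euclNorm x := norm_nonneg _

lemma euclNorm_sq {n : ℕ} (x : Fin n → ℝ) : euclNorm x ^ 2 = x ⬝ᵥ x := by
  rw [euclNorm, EuclideanSpace.real_norm_sq_eq]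
  simp [dotProduct, sq]

lemma euclNorm_mulVec_le {m n : ℕ} (M : Matrix (Fin m) (Fin n) ℝ) (x : Fin n → ℝ) :
    euclNorm (M *ᵥ x) ≤ ‖M‖ * euclNorm x :=
  M.l2_opNorm_mulVec (WithLp.toLp 2 x)

lemma abs_dotProduct_le {n : ℕ} (x y : Fin n → ℝ) : |x ⬝ᵥ y| ≤ euclNorm x * euclNorm y := by
  have h := abs_real_inner_le_norm (WithLp.toLp 2 y) (WithLp.toLp 2 x)
  rw [EuclideanSpace.inner_toLp_toLp] at h
  rw [euclNorm, euclNorm, mul_comm]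
  simpa using h

lemma abs_dotProduct_mulVec_le {m n : ℕ} (M : Matrix (Fin m) (Fin n) ℝ) (x : Fin m → ℝ)
    (y : Fin n → ℝ) : |x ⬝ᵥ (M *ᵥ y)| ≤ ‖M‖ * euclNorm x * euclNorm y := by
  calc |x ⬝ᵥ (M *ᵥ y)| ≤ euclNorm x * euclNorm (M *ᵥ y) := abs_dotProduct_le _ _
    _ ≤ euclNorm x * (‖M‖ * euclNorm y) := by
        gcongr
        · exact euclNorm_nonneg _
        · exact euclNorm_mulVec_le _ _
    _ = _ := by ring

lemma l2_opNorm_le_of_euclNorm_mulVec_le {m n : ℕ} {M : Matrix (Fin m) (Fin n) ℝ} {c : ℝ}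
    (hc : 0 ≤ c) (h : ∀ x, euclNorm (M *ᵥ x) ≤ c * euclNorm x) : ‖M‖ ≤ c := by
  rw [Matrix.l2_opNorm_def]
  exact ContinuousLinearMap.opNorm_le_bound _ hc fun x => h x.ofLp

lemma Matrix.IsHermitian.dotProduct_mulVec_comm {n : ℕ} {M : Matrix (Fin n) (Fin n) ℝ}
    (hM : M.IsHermitian) (x y : Fin n → ℝ) : x ⬝ᵥ (M *ᵥ y) = y ⬝ᵥ (M *ᵥ x) := by
  rw [Matrix.dotProduct_mulVec, dotProduct_comm, ← Matrix.mulVec_transpose]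
  congr 2

lemma Matrix.PosSemidef.quad_nonneg {n : ℕ} {M : Matrix (Fin n) (Fin n) ℝ}
    (hM : M.PosSemidef) (x : Fin n → ℝ) : 0 ≤ x ⬝ᵥ (M *ᵥ x) := by
  simpa using hM.dotProduct_mulVec_nonneg x

/-- Cauchy–Schwarz: the quadratic polynomial `s ↦ (x + s y)ᵀ M (x + s y)` is nonnegative, so its
discriminant is at most zero. -/
lemma Matrix.PosSemidef.sq_dotProduct_mulVec_le {n : ℕ} {M : Matrix (Fin n) (Fin n) ℝ}
    (hM : M.PosSemidef) (x y : Fin n → ℝ) :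
    (x ⬝ᵥ (M *ᵥ y)) ^ 2 ≤ (x ⬝ᵥ (M *ᵥ x)) * (y ⬝ᵥ (M *ᵥ y)) := by
  have h : ∀ s : ℝ, 0 ≤ (y ⬝ᵥ (M *ᵥ y)) * (s * s) + (2 * (x ⬝ᵥ (M *ᵥ y))) * s
      + x ⬝ᵥ (M *ᵥ x) := by
    intro s
    have := hM.quad_nonneg (x + s • y)
    simp only [Matrix.mulVec_add, Matrix.mulVec_smul, add_dotProduct, dotProduct_add,
      smul_dotProduct, dotProduct_smul, smul_eq_mul] at this
    rw [hM.1.dotProduct_mulVec_comm y x] at this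
    linarith
  have := discrim_le_zero h
  rw [discrim] at this
  linarith

/-- Diagonalize `M` in an orthonormal eigenbasis; for a positive operator each eigenvalue is also a
singular value, hence at least the smallest one. -/
lemma Matrix.PosSemidef.sigmaMin_mul_le {n : ℕ} {M : Matrix (Fin n) (Fin n) ℝ}
    (hM : M.PosSemidef) (x : Fin n → ℝ) : sigmaMin M * euclNorm x ^ 2 ≤ x ⬝ᵥ (M *ᵥ x) := by
  set T := Matrix.toEuclideanLin M with hTdef
  have hT : T.IsPositive := Matrix.isPositive_toEuclideanLin_iff.mpr hM
  have hn : Module.finrank ℝ (EuclideanSpace ℝ (Fin n)) = n := by simp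
  have hev : ∀ i, sigmaMin M ≤ hT.isSymmetric.eigenvalues hn i := by
    intro i
    have hv := hT.isSymmetric.apply_eigenvectorBasis hn i
    have hadj : LinearMap.adjoint T = T := T.isSymmetric_iff_isSelfAdjoint.mp hT.isSymmetric
    -- The square of an eigenvalue of `T` is an eigenvalue of `T* T`, hence a squared singular
    -- value; nonnegativity of the eigenvalue removes the squares.
    have hE : Module.End.HasEigenvalue (LinearMap.adjoint T ∘ₗ T)
        (hT.isSymmetric.eigenvalues hn i ^ 2 : ℝ) := by
      refine Module.End.hasEigenvalue_of_hasEigenvector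
        (x := hT.isSymmetric.eigenvectorBasis hn i) ⟨?_, ?_⟩
      · rw [Module.End.mem_eigenspace_iff, hadj, LinearMap.comp_apply, hv]
        simp only [map_smul, hv, smul_smul, sq]
        rfl
      · exact (hT.isSymmetric.eigenvectorBasis hn).orthonormal.ne_zero i
    obtain ⟨j, hj⟩ := T.isSymmetric_adjoint_comp_self.exists_eigenvalues_eq hn hE
    rw [← T.sq_singularValues_fin hn] at hj
    have hj' : T.singularValues j ^ 2 = hT.isSymmetric.eigenvalues hn i ^ 2 := by
      exact_mod_cast hj
    have h1 : sigmaMin M ≤ T.singularValues j :=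
      T.singularValues_antitone (by have := j.2; omega)
    refine h1.trans (le_of_sq_le_sq hj'.le ?_)
    exact hT.nonneg_eigenvalues hn i
  have hsum : x ⬝ᵥ (M *ᵥ x) = ∑ i, hT.isSymmetric.eigenvalues hn i *
      inner ℝ (hT.isSymmetric.eigenvectorBasis hn i) (WithLp.toLp 2 x) ^ 2 := by
    rw [← Matrix.inner_toEuclideanCLM M (WithLp.toLp 2 x) (WithLp.toLp 2 x),
      ← (hT.isSymmetric.eigenvectorBasis hn).sum_inner_mul_inner]
    refine Finset.sum_congr rfl fun i _ => ?_
    have : inner ℝ (hT.isSymmetric.eigenvectorBasis hn i) (T (WithLp.toLp 2 x)) =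
        hT.isSymmetric.eigenvalues hn i *
          inner ℝ (hT.isSymmetric.eigenvectorBasis hn i) (WithLp.toLp 2 x) := by
      rw [← hT.isSymmetric, hT.isSymmetric.apply_eigenvectorBasis hn i, inner_smul_left]
      simp
    have h2 : (Matrix.toEuclideanCLM (𝕜 := ℝ) M) (WithLp.toLp 2 x) = T (WithLp.toLp 2 x) := rfl
    rw [h2, this, real_inner_comm]
    ring
  rw [hsum, euclNorm, ← (hT.isSymmetric.eigenvectorBasis hn).sum_sq_norm_inner_right,
    Finset.mul_sum]
  refine Finset.sum_le_sum fun i _ => ?_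
  rw [Real.norm_eq_abs, sq_abs]
  exact mul_le_mul_of_nonneg_right (hev i) (sq_nonneg _)

lemma sigmaMin_nonneg {n : ℕ} (M : Matrix (Fin n) (Fin n) ℝ) : 0 ≤ sigmaMin M :=
  LinearMap.singularValues_nonneg _ _

/-- An injective operator has positive singular values at all indices below the dimension. For `n =
0` the truncated index `n - 1` is not below it, hence `NeZero n`. -/
lemma Matrix.PosDef.sigmaMin_pos {n : ℕ} [NeZero n] {M : Matrix (Fin n) (Fin n) ℝ}
    (hM : M.PosDef) : 0 < sigmaMin M := by
  have hinj : Function.Injective (Matrix.toEuclideanLin M) := by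
    rw [injective_iff_map_eq_zero]
    intro v hv
    by_contra hne
    have h0 : v.ofLp ≠ 0 := fun h => hne (by ext i; simp [h])
    have := hM.dotProduct_mulVec_pos h0
    have hz : M *ᵥ v.ofLp = 0 := congrArg WithLp.ofLp hv
    simp [hz] at this
  refine (Matrix.toEuclideanLin M).injective_iff_forall_lt_finrank_singularValues_pos.mp hinj _ ?_
  have := NeZero.pos n
  simp
  omega

lemma exists_euclNorm_eq_one (n : ℕ) [NeZero n] : ∃ x : Fin n → ℝ, euclNorm x = 1 :=
  ⟨Pi.single 0 1, by
    have h : euclNorm (Pi.single (0 : Fin n) (1 : ℝ)) ^ 2 = 1 := by simp [euclNorm_sq]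
    nlinarith [euclNorm_nonneg (Pi.single (0 : Fin n) (1 : ℝ))]⟩

/-- A lower bound for a quadratic form is a lower bound for the operator norm. -/
lemma le_l2_opNorm_of_quad_ge {n : ℕ} [NeZero n] {M : Matrix (Fin n) (Fin n) ℝ} {c : ℝ}
    (h : ∀ x, c * euclNorm x ^ 2 ≤ x ⬝ᵥ (M *ᵥ x)) : c ≤ ‖M‖ := by
  obtain ⟨x, hx⟩ := exists_euclNorm_eq_one n
  have h1 := h x
  have h2 := (le_abs_self _).trans (abs_dotProduct_mulVec_le M x x)
  rw [hx] at h1 h2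
  linarith

/-! ### Expectations over finite paths and the Markov property -/

/-- The path that follows `s` up to time `t` and is constant from then on. -/
def extendPath {α : Type*} {t : ℕ} (s : Fin (t + 1) → α) (r : ℕ) : α :=
  s ⟨min r t, by omega⟩

lemma extendPath_of_le {α : Type*} {t : ℕ} (s : Fin (t + 1) → α) {r : ℕ} (hr : r ≤ t) :
    extendPath s r = s ⟨r, by omega⟩ := by
  simp [extendPath, hr]

lemma extendPath_snoc_of_le {α : Type*} {t : ℕ} (s : Fin (t + 1) → α) (j : α) {r : ℕ}
    (hr : r ≤ t) : extendPath (Fin.snoc s j : Fin (t + 1 + 1) → α) r = extendPath s r := by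
  rw [extendPath_of_le _ (by omega), extendPath_of_le _ hr]
  exact Fin.snoc_castSucc (α := fun _ => α) j s ⟨r, by omega⟩

lemma extendPath_snoc_last {α : Type*} {t : ℕ} (s : Fin (t + 1) → α) (j : α) :
    extendPath (Fin.snoc s j : Fin (t + 1 + 1) → α) (t + 1) = j := by
  rw [extendPath_of_le _ le_rfl]
  exact Fin.snoc_last (α := fun _ => α) j s

namespace MJLS

variable {Ns d k : ℕ}

/-- The probability that the mode process starts with `i 0, …, i t`. -/
noncomputable def pathWeight (S : MJLS Ns d k) (t : ℕ) (i : ℕ → Fin Ns) : ENNReal :=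
  ENNReal.ofReal (S.ini (i 0) * ∏ s ∈ Finset.range t, S.p (i s) (i (s + 1)))

lemma pathWeight_succ (S : MJLS Ns d k) (t : ℕ) (i : ℕ → Fin Ns) :
    S.pathWeight (t + 1) i = S.pathWeight t i * ENNReal.ofReal (S.p (i t) (i (t + 1))) := by
  rw [pathWeight, pathWeight, ← ENNReal.ofReal_mul, Finset.prod_range_succ, mul_assoc]
  exact mul_nonneg (S.ini_pos _).le (Finset.prod_nonneg fun _ _ => S.p_nonneg _ _)

lemma pathWeight_congr (S : MJLS Ns d k) {t : ℕ} {i j : ℕ → Fin Ns} (h : ∀ r ≤ t, i r = j r) :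
    S.pathWeight t i = S.pathWeight t j := by
  rw [pathWeight, pathWeight, h 0 (Nat.zero_le _)]
  congr 2
  refine Finset.prod_congr rfl fun s hs => ?_
  have := Finset.mem_range.mp hs
  rw [h s (by omega), h (s + 1) (by omega)]

variable {Ω : Type*} [MeasurableSpace Ω] {Pr : Measure Ω} {x₀ : Ω → Fin d → ℝ}
  {ω : Ω → ℕ → Fin Ns} {S : MJLS Ns d k}

/-- Expectations of functions of the initial state and of the first modes are finite sums over
paths. -/
lemma IsDrivenBy.lintegral_eq_sum_paths (hS : S.IsDrivenBy Pr x₀ ω) (t : ℕ)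
    {h : (ℕ → Fin Ns) → (Fin d → ℝ) → ENNReal} (hm : ∀ i, Measurable (h i))
    (hloc : ∀ i j, (∀ r ≤ t, i r = j r) → h i = h j) :
    ∫⁻ w, h (ω w) (x₀ w) ∂Pr =
      ∑ s : Fin (t + 1) → Fin Ns, S.pathWeight t (extendPath s) *
        ∫⁻ w, h (extendPath s) (x₀ w) ∂Pr := by
  classical
  let E : (Fin (t + 1) → Fin Ns) → Set (ℕ → Fin Ns) := fun s => {i | ∀ r ≤ t, i r = extendPath s r}
  have hE : ∀ s, MeasurableSet (E s) := by
    intro s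
    have : E s = ⋂ r, ⋂ (_ : r ≤ t), (fun i : ℕ → Fin Ns => i r) ⁻¹' {extendPath s r} := by
      ext i; simp [E]
    rw [this]
    exact MeasurableSet.iInter fun r => MeasurableSet.iInter fun _ =>
      measurable_pi_apply r (MeasurableSet.singleton _)
  -- The cylinders `E s` partition the mode sequences, and `hloc` allows `ω w` to be replaced by the
  -- extended path of its cylinder.
  have hpt : ∀ w, h (ω w) (x₀ w) =
      ∑ s, (E s).indicator (fun _ => (1 : ENNReal)) (ω w) * h (extendPath s) (x₀ w) := by
    intro w
    rw [Finset.sum_eq_single (fun r : Fin (t + 1) => ω w r)]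
    · have hmem : ω w ∈ E (fun r : Fin (t + 1) => ω w r) := by
        intro r hr
        rw [extendPath_of_le _ hr]
      rw [Set.indicator_of_mem hmem, one_mul, hloc _ _ hmem]
    · intro s _ hs
      rw [Set.indicator_of_notMem, zero_mul]
      intro hmem
      refine hs (funext fun r => ?_)
      rw [hmem r (by omega), extendPath_of_le _ (by omega)]
    · simp
  simp_rw [hpt]
  rw [lintegral_finsetSum]
  · refine Finset.sum_congr rfl fun s _ => ?_
    have hind : IndepFun (fun w => (E s).indicator (fun _ => (1 : ENNReal)) (ω w))
        (fun w => h (extendPath s) (x₀ w)) Pr :=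
      hS.indep.symm.comp (measurable_const.indicator (hE s)) (hm _)
    have hmul := lintegral_mul_eq_lintegral_mul_lintegral_of_indepFun
      ((measurable_const.indicator (hE s)).comp hS.measurable_mode)
      ((hm (extendPath s)).comp hS.measurable_state) hind
    refine hmul.trans ?_
    congr 1
    have : ∀ w, (E s).indicator (fun _ => (1 : ENNReal)) (ω w) =
        (ω ⁻¹' E s).indicator (fun _ => (1 : ENNReal)) w := fun w => rfl
    simp only [Function.comp_def, this]
    rw [lintegral_indicator_const (hS.measurable_mode (hE s)), one_mul]
    exact hS.markov t (extendPath s)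
  · intro s _
    exact ((measurable_const.indicator (hE s)).comp hS.measurable_mode).mul
      ((hm _).comp hS.measurable_state)

lemma IsDrivenBy.lintegral_mode_zero (hS : S.IsDrivenBy Pr x₀ ω)
    {g : Fin Ns → (Fin d → ℝ) → ENNReal} (hg : ∀ i, Measurable (g i)) :
    ∫⁻ w, g (ω w 0) (x₀ w) ∂Pr = ∑ i, ENNReal.ofReal (S.ini i) * ∫⁻ w, g i (x₀ w) ∂Pr := by
  rw [hS.lintegral_eq_sum_paths 0 (h := fun i => g (i 0)) (fun i => hg _)
    (fun i j hij => by rw [hij 0 le_rfl])]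
  refine Fintype.sum_equiv (Equiv.funUnique (Fin 1) (Fin Ns)) _ _ fun s => ?_
  simp [pathWeight, extendPath]

/-- The Markov property for functions of the initial state and the modes. -/
lemma IsDrivenBy.lintegral_mode_succ (hS : S.IsDrivenBy Pr x₀ ω) (t : ℕ)
    {f : (ℕ → Fin Ns) → Fin Ns → (Fin d → ℝ) → ENNReal} (hm : ∀ i j, Measurable (f i j))
    (hloc : ∀ i j, (∀ r ≤ t, i r = j r) → f i = f j) :
    ∫⁻ w, f (ω w) (ω w (t + 1)) (x₀ w) ∂Pr =
      ∫⁻ w, ∑ j, ENNReal.ofReal (S.p (ω w t) j) * f (ω w) j (x₀ w) ∂Pr := by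
  rw [hS.lintegral_eq_sum_paths (t + 1) (h := fun i => f i (i (t + 1))) (fun i => hm _ _)
      (fun i j hij => by rw [hloc i j fun r hr => hij r (by omega), hij (t + 1) le_rfl]),
    hS.lintegral_eq_sum_paths t
      (h := fun i x => ∑ j, ENNReal.ofReal (S.p (i t) j) * f i j x)
      (fun i => Finset.measurable_sum _ fun j _ => (hm i j).const_mul _)
      (fun i j hij => by rw [hloc i j hij, hij t le_rfl])]
  -- Split each longer path into its initial part `s` and its last mode `j`; its weight is that of
  -- `s` times one transition probability.
  rw [← Fintype.sum_equiv (Fin.snocEquiv fun _ : Fin (t + 1 + 1) => Fin Ns) _ _ fun _ => rfl,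
    Fintype.sum_prod_type, Finset.sum_comm]
  refine Finset.sum_congr rfl fun s _ => ?_
  have hx : ∀ i j, Measurable fun w => f i j (x₀ w) := fun i j =>
    (hm i j).comp hS.measurable_state
  rw [lintegral_finsetSum _ fun j _ => (hx _ j).const_mul _, Finset.mul_sum]
  refine Finset.sum_congr rfl fun j _ => ?_
  have hle : ∀ r ≤ t, extendPath (Fin.snoc s j : Fin (t + 1 + 1) → Fin Ns) r = extendPath s r :=
    fun r hr => extendPath_snoc_of_le s j hr
  rw [lintegral_const_mul _ (hx _ j), ← mul_assoc]
  change S.pathWeight (t + 1) (extendPath (Fin.snoc s j : Fin (t + 1 + 1) → Fin Ns)) *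
    ∫⁻ w, f (extendPath (Fin.snoc s j : Fin (t + 1 + 1) → Fin Ns))
      (extendPath (Fin.snoc s j : Fin (t + 1 + 1) → Fin Ns) (t + 1)) (x₀ w) ∂Pr = _
  rw [hloc _ _ hle, S.pathWeight_succ, S.pathWeight_congr hle, hle t le_rfl,
    extendPath_snoc_last]

end MJLS

/-! ### Closed loop, backward operator and value iteration -/

namespace MJLS

variable {Ns d k : ℕ}

/-- The closed-loop matrices `A_i - B_i K_i`. -/
def closedLoop (S : MJLS Ns d k) (K : Fin Ns → Matrix (Fin k) (Fin d) ℝ) (i : Fin Ns) :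
    Matrix (Fin d) (Fin d) ℝ :=
  S.A i - S.B i * K i

/-- The matrices `Q_i + K_iᵀ R_i K_i` of the closed-loop running cost. -/
def stageMatrix (S : MJLS Ns d k) (K : Fin Ns → Matrix (Fin k) (Fin d) ℝ) (i : Fin Ns) :
    Matrix (Fin d) (Fin d) ℝ :=
  S.Q i + (K i)ᵀ * S.R i * K i

/-- The conditional means `∑ j, p_ij M_j`. -/
def modeMean (S : MJLS Ns d k) (M : Fin Ns → Matrix (Fin d) (Fin d) ℝ) (i : Fin Ns) :
    Matrix (Fin d) (Fin d) ℝ :=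
  ∑ j, S.p i j • M j

/-- The operator `M ↦ ((A_i - B_i K_i)ᵀ (∑ j, p_ij M_j) (A_i - B_i K_i))_i`. -/
def backward (S : MJLS Ns d k) (K : Fin Ns → Matrix (Fin k) (Fin d) ℝ) :
    (Fin Ns → Matrix (Fin d) (Fin d) ℝ) →ₗ[ℝ] (Fin Ns → Matrix (Fin d) (Fin d) ℝ) where
  toFun M i := (S.closedLoop K i)ᵀ * S.modeMean M i * S.closedLoop K i
  map_add' M M' := by
    ext1 i
    simp [modeMean, Finset.sum_add_distrib, Matrix.mul_add, Matrix.add_mul]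
  map_smul' c M := by
    ext1 i
    have : S.modeMean (c • M) i = c • S.modeMean M i := by
      simp [modeMean, Finset.smul_sum, smul_comm c]
    simp [this]

/-- The total over a horizon `n` of the running cost with matrices `W`, as a function of the
initial mode. -/
noncomputable def valueIter (S : MJLS Ns d k) (K : Fin Ns → Matrix (Fin k) (Fin d) ℝ)
    (W : Fin Ns → Matrix (Fin d) (Fin d) ℝ) (n : ℕ) : Fin Ns → Matrix (Fin d) (Fin d) ℝ :=
  ∑ t ∈ Finset.range n, (S.backward K ^ t) W

variable (S : MJLS Ns d k) (K : Fin Ns → Matrix (Fin k) (Fin d) ℝ)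

/-- Bellman form: the extra step is placed at the beginning of the horizon, which is what the
inductions on the horizon use. -/
lemma valueIter_succ (W : Fin Ns → Matrix (Fin d) (Fin d) ℝ) (n : ℕ) :
    S.valueIter K W (n + 1) = W + S.backward K (S.valueIter K W n) := by
  simp [valueIter, Finset.sum_range_succ', pow_succ', add_comm]

lemma modeMean_quad (M : Fin Ns → Matrix (Fin d) (Fin d) ℝ) (i : Fin Ns) (x y : Fin d → ℝ) :
    x ⬝ᵥ (S.modeMean M i *ᵥ y) = ∑ j, S.p i j * (x ⬝ᵥ (M j *ᵥ y)) := by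
  simp [modeMean, Matrix.sum_mulVec, Matrix.smul_mulVec, dotProduct_sum]

lemma backward_quad_modeMean (M : Fin Ns → Matrix (Fin d) (Fin d) ℝ) (i : Fin Ns)
    (x : Fin d → ℝ) : x ⬝ᵥ (S.backward K M i *ᵥ x) =
      (S.closedLoop K i *ᵥ x) ⬝ᵥ (S.modeMean M i *ᵥ (S.closedLoop K i *ᵥ x)) := by
  simp only [backward, LinearMap.coe_mk, AddHom.coe_mk]
  rw [← Matrix.mulVec_mulVec, ← Matrix.mulVec_mulVec, Matrix.dotProduct_mulVec,
    Matrix.vecMul_transpose]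

lemma backward_quad (M : Fin Ns → Matrix (Fin d) (Fin d) ℝ) (i : Fin Ns) (x : Fin d → ℝ) :
    x ⬝ᵥ (S.backward K M i *ᵥ x) =
      ∑ j, S.p i j * ((S.closedLoop K i *ᵥ x) ⬝ᵥ (M j *ᵥ (S.closedLoop K i *ᵥ x))) := by
  rw [backward_quad_modeMean, modeMean_quad]

lemma stageMatrix_quad (i : Fin Ns) (x : Fin d → ℝ) :
    x ⬝ᵥ (S.stageMatrix K i *ᵥ x) =
      x ⬝ᵥ (S.Q i *ᵥ x) + (K i *ᵥ x) ⬝ᵥ (S.R i *ᵥ (K i *ᵥ x)) := by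
  rw [stageMatrix, Matrix.add_mulVec, dotProduct_add, ← Matrix.mulVec_mulVec,
    ← Matrix.mulVec_mulVec, Matrix.dotProduct_mulVec x (K i)ᵀ, Matrix.vecMul_transpose]

lemma stageCost_control (i : Fin Ns) (x : Fin d → ℝ) :
    S.stageCost i x (control K i x) = x ⬝ᵥ (S.stageMatrix K i *ᵥ x) := by
  rw [stageMatrix_quad, stageCost, control]
  simp [Matrix.mulVec_neg]

lemma state_succ (x : Fin d → ℝ) (ω : ℕ → Fin Ns) (t : ℕ) :
    S.state K x ω (t + 1) = S.closedLoop K (ω t) *ᵥ S.state K x ω t := by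
  rw [state, control, closedLoop, Matrix.sub_mulVec, Matrix.mulVec_neg, Matrix.mulVec_mulVec,
    sub_eq_add_neg]

lemma stageMatrix_posSemidef (i : Fin Ns) : (S.stageMatrix K i).PosSemidef := by
  have := (S.R_posDef i).posSemidef.conjTranspose_mul_mul_same (K i)
  rw [Matrix.conjTranspose_eq_transpose_of_trivial] at this
  exact (S.Q_posDef i).posSemidef.add this

lemma modeMean_posSemidef {M : Fin Ns → Matrix (Fin d) (Fin d) ℝ}
    (hM : ∀ i, (M i).PosSemidef) (i : Fin Ns) : (S.modeMean M i).PosSemidef :=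
  Matrix.posSemidef_sum _ fun j _ => (hM j).smul (S.p_nonneg i j)

lemma backward_posSemidef {M : Fin Ns → Matrix (Fin d) (Fin d) ℝ}
    (hM : ∀ i, (M i).PosSemidef) (i : Fin Ns) : (S.backward K M i).PosSemidef := by
  have := (S.modeMean_posSemidef hM i).conjTranspose_mul_mul_same (S.closedLoop K i)
  rwa [Matrix.conjTranspose_eq_transpose_of_trivial] at this

lemma valueIter_posSemidef {W : Fin Ns → Matrix (Fin d) (Fin d) ℝ}
    (hW : ∀ i, (W i).PosSemidef) (n : ℕ) (i : Fin Ns) : (S.valueIter K W n i).PosSemidef := by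
  induction n generalizing i with
  | zero => simpa [valueIter] using Matrix.PosSemidef.zero
  | succ n ih =>
    rw [valueIter_succ]
    exact (hW i).add (S.backward_posSemidef K ih i)

lemma modeMean_norm_le {M : Fin Ns → Matrix (Fin d) (Fin d) ℝ} {c : ℝ} (hM : ∀ i, ‖M i‖ ≤ c)
    (i : Fin Ns) : ‖S.modeMean M i‖ ≤ c := by
  calc ‖S.modeMean M i‖ ≤ ∑ j, ‖S.p i j • M j‖ := norm_sum_le _ _
    _ ≤ ∑ j, S.p i j * c := Finset.sum_le_sum fun j _ => by
        rw [norm_smul, Real.norm_of_nonneg (S.p_nonneg i j)]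
        exact mul_le_mul_of_nonneg_left (hM j) (S.p_nonneg i j)
    _ = c := by rw [← Finset.sum_mul, S.p_sum, one_mul]

lemma backward_quad_mono {M M' : Fin Ns → Matrix (Fin d) (Fin d) ℝ}
    (h : ∀ i x, x ⬝ᵥ (M i *ᵥ x) ≤ x ⬝ᵥ (M' i *ᵥ x)) (i : Fin Ns) (x : Fin d → ℝ) :
    x ⬝ᵥ (S.backward K M i *ᵥ x) ≤ x ⬝ᵥ (S.backward K M' i *ᵥ x) := by
  rw [backward_quad, backward_quad]
  exact Finset.sum_le_sum fun j _ => mul_le_mul_of_nonneg_left (h _ _) (S.p_nonneg i j)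

variable {S K} in
/-- If `V n` decreases by at least `l` times the energy per step under the policy `K`, then
`l` times the expected energy over a finite horizon is at most `V`. -/
lemma smul_valueIter_one_le {V : ℕ → Fin Ns → Matrix (Fin d) (Fin d) ℝ} {l : ℝ}
    (h0 : ∀ i x, 0 ≤ x ⬝ᵥ (V 0 i *ᵥ x))
    (h : ∀ n i x, l * euclNorm x ^ 2 + x ⬝ᵥ (S.backward K (V n) i *ᵥ x) ≤
      x ⬝ᵥ (V (n + 1) i *ᵥ x)) (n : ℕ) (i : Fin Ns) (x : Fin d → ℝ) :
    x ⬝ᵥ ((l • S.valueIter K 1 n) i *ᵥ x) ≤ x ⬝ᵥ (V n i *ᵥ x) := by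
  induction n generalizing i x with
  | zero => simpa [valueIter] using h0 i x
  | succ n ih =>
    -- The induction hypothesis passes through `backward`, which is monotone for quadratic forms;
    -- the identity matrices contribute the term `l |x|²`.
    refine le_trans ?_ (h n i x)
    have := S.backward_quad_mono K ih i x
    rw [valueIter_succ, smul_add, Pi.add_apply, Matrix.add_mulVec, dotProduct_add, ← map_smul,
      euclNorm_sq]
    refine add_le_add (le_of_eq ?_) this
    simp [Matrix.smul_mulVec]

end MJLS

/-! ### Averages over the initial state and the cost as a supremum -/

namespace MJLS

variable {Ns d k : ℕ} {Ω : Type*} [MeasurableSpace Ω] {Pr : Measure Ω} {x₀ : Ω → Fin d → ℝ}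
  {ω : Ω → ℕ → Fin Ns} {S : MJLS Ns d k}

/-- The expectation `∑ i, π_i E[x₀ᵀ M_i x₀]`. -/
noncomputable def meanQuad (S : MJLS Ns d k) (Pr : Measure Ω) (x₀ : Ω → Fin d → ℝ)
    (M : Fin Ns → Matrix (Fin d) (Fin d) ℝ) : ℝ :=
  ∑ i, S.ini i * ∫ w, x₀ w ⬝ᵥ (M i *ᵥ x₀ w) ∂Pr

lemma measurable_quad (M : Matrix (Fin d) (Fin d) ℝ) :
    Measurable fun x : Fin d → ℝ => x ⬝ᵥ (M *ᵥ x) :=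
  (Continuous.dotProduct continuous_id (continuous_const.matrix_mulVec continuous_id)).measurable

lemma IsDrivenBy.integrable_mul (hS : S.IsDrivenBy Pr x₀ ω) (a b : Fin d) :
    Integrable (fun w => x₀ w a * x₀ w b) Pr :=
  (hS.memLp.eval a).integrable_mul (hS.memLp.eval b)

lemma IsDrivenBy.integrable_quad (hS : S.IsDrivenBy Pr x₀ ω) (M : Matrix (Fin d) (Fin d) ℝ) :
    Integrable (fun w => x₀ w ⬝ᵥ (M *ᵥ x₀ w)) Pr := by
  simp only [dotProduct, Matrix.mulVec, Finset.mul_sum]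
  refine integrable_finsetSum _ fun a _ => integrable_finsetSum _ fun b _ => ?_
  convert! (hS.integrable_mul a b).const_mul (M a b) using 2
  ring

lemma IsDrivenBy.secondMoment_quad (hS : S.IsDrivenBy Pr x₀ ω) (v : Fin d → ℝ) :
    ∫ w, (v ⬝ᵥ x₀ w) ^ 2 ∂Pr = v ⬝ᵥ (secondMoment Pr x₀ *ᵥ v) := by
  have : ∀ w, (v ⬝ᵥ x₀ w) ^ 2 = ∑ a, ∑ b, v a * v b * (x₀ w a * x₀ w b) := by
    intro w
    rw [sq, dotProduct, Finset.sum_mul_sum]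
    refine Finset.sum_congr rfl fun a _ => Finset.sum_congr rfl fun b _ => ?_
    ring
  simp_rw [this]
  rw [integral_finsetSum _ fun a _ => integrable_finsetSum _ fun b _ =>
    (hS.integrable_mul a b).const_mul _]
  simp only [dotProduct, Matrix.mulVec, Finset.mul_sum]
  refine Finset.sum_congr rfl fun a _ => ?_
  rw [integral_finsetSum _ fun b _ => (hS.integrable_mul a b).const_mul _]
  refine Finset.sum_congr rfl fun b _ => ?_
  rw [integral_const_mul, secondMoment, Matrix.of_apply]
  ring

lemma IsDrivenBy.meanQuad_add (hS : S.IsDrivenBy Pr x₀ ω)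
    (M M' : Fin Ns → Matrix (Fin d) (Fin d) ℝ) :
    S.meanQuad Pr x₀ (M + M') = S.meanQuad Pr x₀ M + S.meanQuad Pr x₀ M' := by
  simp only [meanQuad, ← Finset.sum_add_distrib, ← mul_add]
  refine Finset.sum_congr rfl fun i _ => ?_
  rw [← integral_add (hS.integrable_quad _) (hS.integrable_quad _)]
  simp [Matrix.add_mulVec]

lemma meanQuad_smul (c : ℝ) (M : Fin Ns → Matrix (Fin d) (Fin d) ℝ) :
    S.meanQuad Pr x₀ (c • M) = c * S.meanQuad Pr x₀ M := by
  simp only [meanQuad, Finset.mul_sum]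
  refine Finset.sum_congr rfl fun i _ => ?_
  simp [Matrix.smul_mulVec, integral_const_mul]
  ring

lemma IsDrivenBy.meanQuad_mono (hS : S.IsDrivenBy Pr x₀ ω)
    {M M' : Fin Ns → Matrix (Fin d) (Fin d) ℝ}
    (h : ∀ i x, x ⬝ᵥ (M i *ᵥ x) ≤ x ⬝ᵥ (M' i *ᵥ x)) :
    S.meanQuad Pr x₀ M ≤ S.meanQuad Pr x₀ M' :=
  Finset.sum_le_sum fun i _ => mul_le_mul_of_nonneg_left
    (integral_mono (hS.integrable_quad _) (hS.integrable_quad _) fun _ => h i _) (S.ini_pos i).le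

lemma meanQuad_nonneg {M : Fin Ns → Matrix (Fin d) (Fin d) ℝ}
    (hM : ∀ i, (M i).PosSemidef) : 0 ≤ S.meanQuad Pr x₀ M :=
  Finset.sum_nonneg fun i _ => mul_nonneg (S.ini_pos i).le
    (integral_nonneg fun _ => (hM i).quad_nonneg _)

lemma IsDrivenBy.meanQuad_valueIter_succ (hS : S.IsDrivenBy Pr x₀ ω)
    (K : Fin Ns → Matrix (Fin k) (Fin d) ℝ) (W : Fin Ns → Matrix (Fin d) (Fin d) ℝ) (n : ℕ) :
    S.meanQuad Pr x₀ (S.valueIter K W (n + 1)) =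
      S.meanQuad Pr x₀ (S.valueIter K W n) + S.meanQuad Pr x₀ ((S.backward K ^ n) W) := by
  rw [valueIter, Finset.sum_range_succ, hS.meanQuad_add]
  rfl

lemma IsDrivenBy.meanQuad_valueIter (hS : S.IsDrivenBy Pr x₀ ω)
    (K : Fin Ns → Matrix (Fin k) (Fin d) ℝ) (W : Fin Ns → Matrix (Fin d) (Fin d) ℝ) (n : ℕ) :
    S.meanQuad Pr x₀ (S.valueIter K W n) =
      ∑ t ∈ Finset.range n, S.meanQuad Pr x₀ ((S.backward K ^ t) W) := by
  induction n with
  | zero => simp [valueIter, meanQuad]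
  | succ n ih => rw [hS.meanQuad_valueIter_succ, Finset.sum_range_succ, ih]

/-- Excitation turns a bound on the mean of a nonnegative quadratic form into a norm bound. -/
lemma IsDrivenBy.excitation_mul_norm_le (hS : S.IsDrivenBy Pr x₀ ω)
    {M : Fin Ns → Matrix (Fin d) (Fin d) ℝ} (hM : ∀ i, (M i).PosSemidef)
    (hpos : 0 < S.excitation Pr x₀) (i : Fin Ns) :
    S.excitation Pr x₀ * ‖M i‖ ≤ S.meanQuad Pr x₀ M := by
  set J := S.meanQuad Pr x₀ M with hJ
  have hJ0 : 0 ≤ J := meanQuad_nonneg hM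
  have hI : S.ini i * ∫ w, x₀ w ⬝ᵥ (M i *ᵥ x₀ w) ∂Pr ≤ J :=
    Finset.single_le_sum
      (f := fun i => S.ini i * ∫ w, x₀ w ⬝ᵥ (M i *ᵥ x₀ w) ∂Pr)
      (fun j _ => mul_nonneg (S.ini_pos j).le
        (integral_nonneg fun _ => (hM j).quad_nonneg _)) (Finset.mem_univ i)
  rw [mul_comm, ← le_div_iff₀ hpos]
  refine l2_opNorm_le_of_euclNorm_mulVec_le (by positivity) fun v => ?_
  set y := M i *ᵥ v with hy
  -- Cauchy–Schwarz for the form `M i`, applied to `v` and `x₀` and integrated. The left side is the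
  -- second moment form at `y`, which dominates `σ_min |y|²`.
  have h1 : ∫ w, (y ⬝ᵥ x₀ w) ^ 2 ∂Pr ≤
      (v ⬝ᵥ y) * ∫ w, x₀ w ⬝ᵥ (M i *ᵥ x₀ w) ∂Pr := by
    rw [← integral_const_mul]
    refine integral_mono_of_nonneg (ae_of_all _ fun _ => sq_nonneg _)
      ((hS.integrable_quad _).const_mul _) (ae_of_all _ fun w => ?_)
    have := (hM i).sq_dotProduct_mulVec_le v (x₀ w)
    rw [(hM i).1.dotProduct_mulVec_comm v (x₀ w), dotProduct_comm] at this
    exact this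
  rw [hS.secondMoment_quad] at h1
  have h2 := hS.posDef.posSemidef.sigmaMin_mul_le y
  have hvy0 : 0 ≤ v ⬝ᵥ y := (hM i).quad_nonneg v
  have hvy : v ⬝ᵥ y ≤ euclNorm v * euclNorm y := (le_abs_self _).trans (abs_dotProduct_le _ _)
  have hinf : ⨅ i, S.ini i ≤ S.ini i := ciInf_le (Set.finite_range _).bddBelow i
  have h3 : S.excitation Pr x₀ * euclNorm y ^ 2 ≤ J * (euclNorm v * euclNorm y) :=
    calc S.excitation Pr x₀ * euclNorm y ^ 2
        ≤ S.ini i * (sigmaMin (secondMoment Pr x₀) * euclNorm y ^ 2) := by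
          rw [excitation, mul_assoc]
          exact mul_le_mul_of_nonneg_right hinf
            (mul_nonneg (sigmaMin_nonneg _) (sq_nonneg _))
      _ ≤ S.ini i * ((v ⬝ᵥ y) * ∫ w, x₀ w ⬝ᵥ (M i *ᵥ x₀ w) ∂Pr) :=
          mul_le_mul_of_nonneg_left (h2.trans h1) (S.ini_pos i).le
      _ = (v ⬝ᵥ y) * (S.ini i * ∫ w, x₀ w ⬝ᵥ (M i *ᵥ x₀ w) ∂Pr) := by ring
      _ ≤ (v ⬝ᵥ y) * J := mul_le_mul_of_nonneg_left hI hvy0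
      _ ≤ _ := by rw [mul_comm J]; exact mul_le_mul_of_nonneg_right hvy hJ0
  -- One factor `|y|` is to be cancelled in `h3`.
  rcases (euclNorm_nonneg y).eq_or_lt with h0 | h0
  · rw [← h0]
    have := euclNorm_nonneg v
    positivity
  · rw [div_mul_eq_mul_div, le_div_iff₀ hpos]
    refine le_of_mul_le_mul_right ?_ h0
    linarith [h3]

lemma measurable_state_path (K : Fin Ns → Matrix (Fin k) (Fin d) ℝ) (i : ℕ → Fin Ns) (t : ℕ) :
    Measurable fun x => S.state K x i t := by
  refine Continuous.measurable ?_
  induction t with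
  | zero => exact continuous_id
  | succ t ih =>
    simp_rw [state_succ]
    exact continuous_const.matrix_mulVec ih

lemma state_congr (K : Fin Ns → Matrix (Fin k) (Fin d) ℝ) (x : Fin d → ℝ) {i j : ℕ → Fin Ns}
    {t : ℕ} (h : ∀ r < t, i r = j r) : S.state K x i t = S.state K x j t := by
  induction t with
  | zero => rfl
  | succ t ih => rw [state_succ, state_succ, ih fun r hr => h r (by omega), h t (by omega)]

lemma IsDrivenBy.measurable_apply_mode (hS : S.IsDrivenBy Pr x₀ ω) {β : Type*}
    [MeasurableSpace β] {E : Type*} [MeasurableSpace E] {g : Fin Ns → E → β}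
    (hg : ∀ i, Measurable (g i)) {y : Ω → E} (hy : Measurable y) (t : ℕ) :
    Measurable fun w => g (ω w t) (y w) := by
  have h : Measurable fun q : Fin Ns × E => g q.1 q.2 := measurable_from_prod_countable_right hg
  exact h.comp (((measurable_pi_apply t).comp hS.measurable_mode).prodMk hy)

lemma IsDrivenBy.measurable_trajectory (hS : S.IsDrivenBy Pr x₀ ω)
    (K : Fin Ns → Matrix (Fin k) (Fin d) ℝ) (t : ℕ) :
    Measurable fun w => S.state K (x₀ w) (ω w) t := by
  induction t with
  | zero => exact hS.measurable_state
  | succ t ih =>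
    simp_rw [state_succ]
    exact hS.measurable_apply_mode
      (fun i => (continuous_const.matrix_mulVec continuous_id).measurable) ih t

/-- The expectation of a quadratic form of the state at time `t`. -/
lemma IsDrivenBy.lintegral_quad_state (hS : S.IsDrivenBy Pr x₀ ω)
    (K : Fin Ns → Matrix (Fin k) (Fin d) ℝ) (t : ℕ) {M : Fin Ns → Matrix (Fin d) (Fin d) ℝ}
    (hM : ∀ i, (M i).PosSemidef) :
    ∫⁻ w, ENNReal.ofReal
      (S.state K (x₀ w) (ω w) t ⬝ᵥ (M (ω w t) *ᵥ S.state K (x₀ w) (ω w) t)) ∂Pr =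
      ENNReal.ofReal (S.meanQuad Pr x₀ ((S.backward K ^ t) M)) := by
  induction t generalizing M with
  | zero =>
    simp only [state, pow_zero, Module.End.one_apply]
    rw [hS.lintegral_mode_zero (g := fun i x => ENNReal.ofReal (x ⬝ᵥ (M i *ᵥ x)))
      fun i => (measurable_quad _).ennreal_ofReal, meanQuad,
      ENNReal.ofReal_sum_of_nonneg fun i _ => mul_nonneg (S.ini_pos i).le
        (integral_nonneg fun _ => (hM i).quad_nonneg _)]
    refine Finset.sum_congr rfl fun i _ => ?_
    rw [ENNReal.ofReal_mul (S.ini_pos i).le, ofReal_integral_eq_lintegral_ofReal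
      (hS.integrable_quad _) (ae_of_all _ fun _ => (hM i).quad_nonneg _)]
  | succ t ih =>
    -- The state at time `t + 1` depends only on the modes up to time `t`, so averaging over the
    -- next mode turns the form `M` at time `t + 1` into `backward` of `M` at time `t`.
    rw [hS.lintegral_mode_succ t
      (f := fun i j x => ENNReal.ofReal (S.state K x i (t + 1) ⬝ᵥ (M j *ᵥ S.state K x i (t + 1))))
      (fun i j => ((measurable_quad (M j)).comp (measurable_state_path K i _)).ennreal_ofReal)
      (fun i j hij => by
        ext j' x
        rw [state_congr K x fun r hr => hij r (by omega)]),
      pow_succ, Module.End.mul_apply, ← ih (S.backward_posSemidef K hM)]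
    refine lintegral_congr fun w => ?_
    rw [backward_quad, ENNReal.ofReal_sum_of_nonneg fun j _ =>
      mul_nonneg (S.p_nonneg _ j) ((hM j).quad_nonneg _)]
    refine Finset.sum_congr rfl fun j _ => ?_
    rw [ENNReal.ofReal_mul (S.p_nonneg _ j), state_succ]

lemma IsDrivenBy.cost_eq_tsum (hS : S.IsDrivenBy Pr x₀ ω)
    (K : Fin Ns → Matrix (Fin k) (Fin d) ℝ) :
    S.cost Pr x₀ ω K =
      ∑' t, ENNReal.ofReal (S.meanQuad Pr x₀ ((S.backward K ^ t) (S.stageMatrix K))) := by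
  rw [cost]
  simp_rw [stageCost_control]
  rw [lintegral_tsum fun t => (hS.measurable_apply_mode
    (g := fun i x => ENNReal.ofReal (x ⬝ᵥ (S.stageMatrix K i *ᵥ x)))
    (fun i => (measurable_quad _).ennreal_ofReal) (hS.measurable_trajectory K t) t).aemeasurable]
  exact tsum_congr fun t => hS.lintegral_quad_state K t (S.stageMatrix_posSemidef K)

lemma backward_pow_posSemidef (K : Fin Ns → Matrix (Fin k) (Fin d) ℝ) (t : ℕ)
    {M : Fin Ns → Matrix (Fin d) (Fin d) ℝ} (hM : ∀ i, (M i).PosSemidef) (i : Fin Ns) :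
    ((S.backward K ^ t) M i).PosSemidef := by
  induction t generalizing M with
  | zero => exact hM i
  | succ t ih =>
    rw [pow_succ, Module.End.mul_apply]
    exact ih (S.backward_posSemidef K hM)

/-- The cost is the supremum of the finite-horizon costs. -/
lemma IsDrivenBy.cost_eq_iSup (hS : S.IsDrivenBy Pr x₀ ω)
    (K : Fin Ns → Matrix (Fin k) (Fin d) ℝ) :
    S.cost Pr x₀ ω K =
      ⨆ n, ENNReal.ofReal (S.meanQuad Pr x₀ (S.valueIter K (S.stageMatrix K) n)) := by
  rw [hS.cost_eq_tsum, ENNReal.tsum_eq_iSup_nat]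
  refine iSup_congr fun n => ?_
  rw [hS.meanQuad_valueIter, ENNReal.ofReal_sum_of_nonneg fun t _ =>
    meanQuad_nonneg (backward_pow_posSemidef K t (S.stageMatrix_posSemidef K))]

lemma IsDrivenBy.meanQuad_valueIter_le_cost (hS : S.IsDrivenBy Pr x₀ ω)
    {K : Fin Ns → Matrix (Fin k) (Fin d) ℝ} (hK : S.cost Pr x₀ ω K ≠ ⊤) (n : ℕ) :
    S.meanQuad Pr x₀ (S.valueIter K (S.stageMatrix K) n) ≤ (S.cost Pr x₀ ω K).toReal := by
  rw [← ENNReal.ofReal_le_iff_le_toReal hK, hS.cost_eq_iSup]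
  exact le_iSup
    (fun n => ENNReal.ofReal (S.meanQuad Pr x₀ (S.valueIter K (S.stageMatrix K) n))) n

lemma IsDrivenBy.cost_le (hS : S.IsDrivenBy Pr x₀ ω)
    {K : Fin Ns → Matrix (Fin k) (Fin d) ℝ} {c : ℝ}
    (h : ∀ n, S.meanQuad Pr x₀ (S.valueIter K (S.stageMatrix K) n) ≤ c) :
    S.cost Pr x₀ ω K ≤ ENNReal.ofReal c := by
  rw [hS.cost_eq_iSup]
  exact iSup_le fun n => ENNReal.ofReal_le_ofReal (h n)

end MJLS

/-! ### Perturbation of the policy -/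

lemma lambdaMin_le_sigmaMin {Ns d : ℕ} (V : Fin Ns → Matrix (Fin d) (Fin d) ℝ) (i : Fin Ns) :
    lambdaMin V ≤ sigmaMin (V i) :=
  ciInf_le (Set.finite_range _).bddBelow i

/-- Perturbation of a symmetric quadratic form. -/
lemma Matrix.IsHermitian.abs_quad_add_sub_le {n : ℕ} {M : Matrix (Fin n) (Fin n) ℝ}
    (hM : M.IsHermitian) (y z : Fin n → ℝ) :
    |(y + z) ⬝ᵥ (M *ᵥ (y + z)) - y ⬝ᵥ (M *ᵥ y)| ≤
      ‖M‖ * (2 * euclNorm y * euclNorm z + euclNorm z ^ 2) := by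
  have h : (y + z) ⬝ᵥ (M *ᵥ (y + z)) - y ⬝ᵥ (M *ᵥ y) =
      2 * (y ⬝ᵥ (M *ᵥ z)) + z ⬝ᵥ (M *ᵥ z) := by
    simp only [Matrix.mulVec_add, add_dotProduct, dotProduct_add]
    rw [hM.dotProduct_mulVec_comm z y]
    ring
  rw [h]
  have h1 := abs_dotProduct_mulVec_le M y z
  have h2 := abs_dotProduct_mulVec_le M z z
  calc |2 * (y ⬝ᵥ (M *ᵥ z)) + z ⬝ᵥ (M *ᵥ z)|
      ≤ |2 * (y ⬝ᵥ (M *ᵥ z))| + |z ⬝ᵥ (M *ᵥ z)| := abs_add_le _ _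
    _ = 2 * |y ⬝ᵥ (M *ᵥ z)| + |z ⬝ᵥ (M *ᵥ z)| := by rw [abs_mul, abs_two]
    _ ≤ 2 * (‖M‖ * euclNorm y * euclNorm z) + ‖M‖ * euclNorm z * euclNorm z := by gcongr
    _ = _ := by ring

namespace MJLS

variable {Ns d k : ℕ} (S : MJLS Ns d k) {K K' : Fin Ns → Matrix (Fin k) (Fin d) ℝ}

lemma lambdaMin_pos [NeZero d] [Nonempty (Fin Ns)] : 0 < lambdaMin S.Q := by
  obtain ⟨i, hi⟩ := exists_eq_ciInf_of_finite (f := fun i => sigmaMin (S.Q i))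
  rw [lambdaMin, ← hi]
  exact (S.Q_posDef i).sigmaMin_pos

/-- Serves to weaken `C/μ` to `ρ‖Q‖/μ`, the quantity in the stated constant. -/
lemma lambdaMin_le_norm [NeZero d] [Nonempty (Fin Ns)] : lambdaMin S.Q ≤ ‖S.Q‖ := by
  obtain ⟨i⟩ := ‹Nonempty (Fin Ns)›
  exact (lambdaMin_le_sigmaMin _ i).trans
    ((le_l2_opNorm_of_quad_ge (S.Q_posDef i).posSemidef.sigmaMin_mul_le).trans (norm_le_pi_norm _ i))

lemma lambdaMin_mul_le_stageMatrix_quad (i : Fin Ns) (x : Fin d → ℝ) :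
    lambdaMin S.Q * euclNorm x ^ 2 ≤ x ⬝ᵥ (S.stageMatrix K i *ᵥ x) := by
  rw [stageMatrix_quad]
  have h1 := (S.Q_posDef i).posSemidef.sigmaMin_mul_le x
  have h2 := (S.R_posDef i).posSemidef.quad_nonneg (K i *ᵥ x)
  have h3 := mul_le_mul_of_nonneg_right (lambdaMin_le_sigmaMin S.Q i) (sq_nonneg (euclNorm x))
  linarith

lemma excitation_pos [NeZero d] [Nonempty (Fin Ns)] {Ω : Type*} [MeasurableSpace Ω]
    {Pr : Measure Ω} {x₀ : Ω → Fin d → ℝ} (h : (secondMoment Pr x₀).PosDef) :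
    0 < S.excitation Pr x₀ := by
  obtain ⟨i, hi⟩ := exists_eq_ciInf_of_finite (f := S.ini)
  rw [excitation, ← hi]
  exact mul_pos (S.ini_pos i) h.sigmaMin_pos

lemma closedLoop_mulVec_perturb (i : Fin Ns) (x : Fin d → ℝ) :
    S.closedLoop K' i *ᵥ x = S.closedLoop K i *ᵥ x + -(S.B i *ᵥ ((K' - K) i *ᵥ x)) := by
  simp only [closedLoop, Pi.sub_apply, Matrix.sub_mulVec, Matrix.mulVec_sub, Matrix.mulVec_mulVec]
  abel

lemma euclNorm_neg {n : ℕ} (x : Fin n → ℝ) : euclNorm (-x) = euclNorm x :=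
  norm_neg (WithLp.toLp 2 x)

lemma euclNorm_apply_mulVec_le {m n : ℕ} (V : Fin Ns → Matrix (Fin m) (Fin n) ℝ) (i : Fin Ns)
    (x : Fin n → ℝ) : euclNorm (V i *ᵥ x) ≤ ‖V‖ * euclNorm x :=
  (euclNorm_mulVec_le _ _).trans
    (mul_le_mul_of_nonneg_right (norm_le_pi_norm V i) (euclNorm_nonneg x))

/-- The effect of a change of policy on one backward step, in terms of the closed loop. -/
lemma abs_backward_quad_sub_le {M : Fin Ns → Matrix (Fin d) (Fin d) ℝ}
    (hM : ∀ i, (M i).PosSemidef) {c : ℝ} (hc : ∀ i, ‖M i‖ ≤ c) (i : Fin Ns) (x : Fin d → ℝ)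
    {l : ℝ} (hl : euclNorm (S.closedLoop K i *ᵥ x) ≤ l * euclNorm x) :
    |x ⬝ᵥ (S.backward K' M i *ᵥ x) - x ⬝ᵥ (S.backward K M i *ᵥ x)| ≤
      c * (2 * l * (‖S.B i‖ * ‖K' - K‖) + (‖S.B i‖ * ‖K' - K‖) ^ 2) * euclNorm x ^ 2 := by
  rw [backward_quad_modeMean, backward_quad_modeMean, S.closedLoop_mulVec_perturb (K := K)]
  refine ((S.modeMean_posSemidef hM i).1.abs_quad_add_sub_le _ _).trans ?_
  rw [euclNorm_neg]
  have h0 := euclNorm_nonneg x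
  have h1 : euclNorm (S.B i *ᵥ ((K' - K) i *ᵥ x)) ≤ ‖S.B i‖ * ‖K' - K‖ * euclNorm x :=
    (euclNorm_mulVec_le _ _).trans (by
      rw [mul_assoc]
      exact mul_le_mul_of_nonneg_left (euclNorm_apply_mulVec_le _ _ _) (norm_nonneg _))
  have h2 := euclNorm_nonneg (S.B i *ᵥ ((K' - K) i *ᵥ x))
  have h3 := euclNorm_nonneg (S.closedLoop K i *ᵥ x)
  have h4 := S.modeMean_norm_le hc i
  calc ‖S.modeMean M i‖ * (2 * euclNorm (S.closedLoop K i *ᵥ x) *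
          euclNorm (S.B i *ᵥ ((K' - K) i *ᵥ x)) + euclNorm (S.B i *ᵥ ((K' - K) i *ᵥ x)) ^ 2)
      ≤ c * (2 * (l * euclNorm x) * (‖S.B i‖ * ‖K' - K‖ * euclNorm x) +
          (‖S.B i‖ * ‖K' - K‖ * euclNorm x) ^ 2) := by
        have := (norm_nonneg _).trans h4
        have := h3.trans hl
        gcongr
    _ = _ := by ring

lemma abs_stageMatrix_quad_sub_le (i : Fin Ns) (x : Fin d → ℝ) :
    |x ⬝ᵥ (S.stageMatrix K' i *ᵥ x) - x ⬝ᵥ (S.stageMatrix K i *ᵥ x)| ≤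
      ‖S.R‖ * (2 * (∑ i, ‖K i‖) * ‖K' - K‖ + ‖K' - K‖ ^ 2) * euclNorm x ^ 2 := by
  have hK : K' i *ᵥ x = K i *ᵥ x + (K' - K) i *ᵥ x := by
    rw [Pi.sub_apply, Matrix.sub_mulVec]
    abel
  rw [stageMatrix_quad, stageMatrix_quad, add_sub_add_left_eq_sub, hK]
  refine ((S.R_posDef i).1.abs_quad_add_sub_le _ _).trans ?_
  have h0 := euclNorm_nonneg x
  have h1 : euclNorm (K i *ᵥ x) ≤ (∑ i, ‖K i‖) * euclNorm x :=
    (euclNorm_mulVec_le _ _).trans (mul_le_mul_of_nonneg_right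
      (Finset.single_le_sum (f := fun i => ‖K i‖) (fun _ _ => norm_nonneg _) (Finset.mem_univ i))
      h0)
  have h2 := euclNorm_apply_mulVec_le (K' - K) i x
  have h3 := euclNorm_nonneg (K i *ᵥ x)
  have h4 := euclNorm_nonneg ((K' - K) i *ᵥ x)
  calc ‖S.R i‖ * (2 * euclNorm (K i *ᵥ x) * euclNorm ((K' - K) i *ᵥ x) +
          euclNorm ((K' - K) i *ᵥ x) ^ 2)
      ≤ ‖S.R‖ * (2 * ((∑ i, ‖K i‖) * euclNorm x) * (‖K' - K‖ * euclNorm x) +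
          (‖K' - K‖ * euclNorm x) ^ 2) := by
        have := norm_le_pi_norm S.R i
        have := h3.trans h1
        gcongr
    _ = _ := by ring

lemma euclNorm_closedLoop_mulVec_le (i : Fin Ns) (x : Fin d → ℝ) :
    euclNorm (S.closedLoop K i *ᵥ x) ≤ (‖S.A‖ + ‖S.B‖ * ∑ i, ‖K i‖) * euclNorm x := by
  refine (euclNorm_mulVec_le _ _).trans (mul_le_mul_of_nonneg_right ?_ (euclNorm_nonneg x))
  refine (norm_sub_le _ _).trans (add_le_add (norm_le_pi_norm S.A i) ?_)
  refine (Matrix.l2_opNorm_mul _ _).trans (mul_le_mul (norm_le_pi_norm S.B i) ?_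
    (norm_nonneg _) (norm_nonneg _))
  exact Finset.single_le_sum (f := fun i => ‖K i‖) (fun _ _ => norm_nonneg _) (Finset.mem_univ i)

/-- The effect of a change of policy on one step of value iteration. -/
lemma abs_stage_add_backward_sub_le {M : Fin Ns → Matrix (Fin d) (Fin d) ℝ}
    (hM : ∀ i, (M i).PosSemidef) {c : ℝ} (hc0 : 0 ≤ c) (hc : ∀ i, ‖M i‖ ≤ c)
    (hcap : ‖K' - K‖ ≤ ∑ i, ‖K i‖) (i : Fin Ns) (x : Fin d → ℝ) :
    |(x ⬝ᵥ (S.stageMatrix K' i *ᵥ x) + x ⬝ᵥ (S.backward K' M i *ᵥ x)) -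
        (x ⬝ᵥ (S.stageMatrix K i *ᵥ x) + x ⬝ᵥ (S.backward K M i *ᵥ x))| ≤
      (3 * (‖S.R‖ + ‖S.B‖ ^ 2 * c) * (∑ i, ‖K i‖) + 2 * ‖S.A‖ * ‖S.B‖ * c) * ‖K' - K‖ *
        euclNorm x ^ 2 := by
  have h1 := S.abs_stageMatrix_quad_sub_le (K := K) (K' := K') i x
  have h2 := S.abs_backward_quad_sub_le (K' := K') hM hc i x
    (S.euclNorm_closedLoop_mulVec_le (K := K) i x)
  have hB := norm_le_pi_norm S.B i
  set κ := ∑ i, ‖K i‖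
  have hκ : 0 ≤ κ := Finset.sum_nonneg fun _ _ => norm_nonneg _
  have hδ := norm_nonneg (K' - K)
  set δ := ‖K' - K‖
  -- The cap `δ ≤ κ` makes the quadratic remainders linear in `δ`; added to the cross terms `2κδ`
  -- they give the factor 3.
  have hsq : δ ^ 2 ≤ κ * δ := by rw [sq]; exact mul_le_mul_of_nonneg_right hcap hδ
  have h3 : ‖S.R‖ * (2 * κ * δ + δ ^ 2) ≤ ‖S.R‖ * (2 * κ * δ + κ * δ) := by gcongr
  have h4 : c * (2 * (‖S.A‖ + ‖S.B‖ * κ) * (‖S.B i‖ * δ) + (‖S.B i‖ * δ) ^ 2) ≤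
      c * (2 * (‖S.A‖ + ‖S.B‖ * κ) * (‖S.B‖ * δ) + ‖S.B‖ ^ 2 * (κ * δ)) := by
    rw [mul_pow]
    gcongr
  rw [add_sub_add_comm]
  calc _ ≤ _ := abs_add_le _ _
    _ ≤ _ := add_le_add h1 h2
    _ ≤ ‖S.R‖ * (2 * κ * δ + κ * δ) * euclNorm x ^ 2 +
        c * (2 * (‖S.A‖ + ‖S.B‖ * κ) * (‖S.B‖ * δ) + ‖S.B‖ ^ 2 * (κ * δ)) * euclNorm x ^ 2 := by
        gcongr
    _ = _ := by ring

/-- The difference of the values of two policies over a finite horizon is controlled by the energy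
of the trajectories of the second policy. -/
lemma neg_smul_valueIter_one_le_of_step {W W' : Fin Ns → Matrix (Fin d) (Fin d) ℝ} {c : ℝ}
    (h : ∀ n i x, |(x ⬝ᵥ (W' i *ᵥ x) + x ⬝ᵥ (S.backward K' (S.valueIter K W n) i *ᵥ x)) -
        (x ⬝ᵥ (W i *ᵥ x) + x ⬝ᵥ (S.backward K (S.valueIter K W n) i *ᵥ x))| ≤
        c * euclNorm x ^ 2) (ε : ℝ) (hε : |ε| = 1) (n : ℕ) (i : Fin Ns) (x : Fin d → ℝ) :
    x ⬝ᵥ ((-c • S.valueIter K' 1 n) i *ᵥ x) ≤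
      x ⬝ᵥ ((ε • (S.valueIter K' W' n - S.valueIter K W n)) i *ᵥ x) := by
  -- The Lyapunov lemma is applied with the negative rate `l = -c` to the signed difference of the
  -- two values; the sign `ε` covers both directions.
  refine smul_valueIter_one_le (V := fun n => ε • (S.valueIter K' W' n - S.valueIter K W n))
    (fun i x => by simp [valueIter]) (fun n i x => ?_) n i x
  rw [map_smul, map_sub, valueIter_succ, valueIter_succ]
  simp only [Pi.smul_apply, Pi.sub_apply, Pi.add_apply, Matrix.smul_mulVec, Matrix.sub_mulVec,
    Matrix.add_mulVec, dotProduct_smul, dotProduct_sub, dotProduct_add, smul_eq_mul]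
  have h1 := h n i x
  rw [← one_mul |_|, ← hε, ← abs_mul] at h1
  have h2 := (abs_le.mp h1).1
  linarith

end MJLS

/-! ### The Lipschitz estimate -/

theorem mainTheorem4 {Ns d k : ℕ} (S : MJLS Ns d k)
    {Ω : Type*} [MeasurableSpace Ω] (Pr : Measure Ω) [IsProbabilityMeasure Pr]
    (x₀ : Ω → Fin d → ℝ) (ω : Ω → ℕ → Fin Ns) (hS : S.IsDrivenBy Pr x₀ ω)
    (K K' : Fin Ns → Matrix (Fin k) (Fin d) ℝ)
    (hK : S.cost Pr x₀ ω K ≠ ⊤)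
    (hradius : ‖K' - K‖ * (4 * (S.cost Pr x₀ ω K).toReal *
        ∑ i, ‖S.B i‖ * (‖S.A i - S.B i * K i‖ + 1)) ≤ lambdaMin S.Q * S.excitation Pr x₀)
    (hcap : ‖K' - K‖ ≤ ∑ i, ‖K i‖) :
    S.cost Pr x₀ ω K' ≠ ⊤ ∧
      |(S.cost Pr x₀ ω K').toReal - (S.cost Pr x₀ ω K).toReal| ≤
        cDiff ‖S.A‖ ‖S.B‖ ‖S.Q‖ ‖S.R‖ (∑ i, ‖K i‖)
          ((S.cost Pr x₀ ω K).toReal / lambdaMin S.Q) (S.excitation Pr x₀) * ‖K' - K‖ := by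
  -- For `d = 0` positivity of `Λ` and `μ` is not available, but matrices with no columns are all
  -- equal.
  rcases Nat.eq_zero_or_pos d with rfl | hd
  · have : K' = K := Subsingleton.elim _ _
    subst this
    exact ⟨hK, by simp⟩
  have : NeZero d := ⟨hd.ne'⟩
  have : Nonempty (Fin Ns) := ⟨ω (Pr.nonempty_of_neZero.some) 0⟩
  have hΛ := S.lambdaMin_pos
  have hΛQ := S.lambdaMin_le_norm
  have hμ := S.excitation_pos hS.posDef
  set C := (S.cost Pr x₀ ω K).toReal with hC
  set Λ := lambdaMin S.Q
  set μ := S.excitation Pr x₀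
  set P := S.valueIter K (S.stageMatrix K) with hP
  have hPpos : ∀ n i, (P n i).PosSemidef := S.valueIter_posSemidef K (S.stageMatrix_posSemidef K)
  have hJP : ∀ n, S.meanQuad Pr x₀ (P n) ≤ C := hS.meanQuad_valueIter_le_cost hK
  have hPnorm : ∀ n i, ‖P n i‖ ≤ C / μ := fun n i => by
    rw [le_div_iff₀ hμ, mul_comm]
    exact (hS.excitation_mul_norm_le (hPpos n) hμ i).trans (hJP n)
  -- The one-step value is already at least `Λ`. This gives `C > 0` and, later, the bound on `‖B_i‖
  -- δ`.
  have hΛC : Λ * μ ≤ C := by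
    obtain ⟨i⟩ := ‹Nonempty (Fin Ns)›
    have h1 : P 1 i = S.stageMatrix K i := by simp [hP, MJLS.valueIter]
    have h2 := le_l2_opNorm_of_quad_ge (S.lambdaMin_mul_le_stageMatrix_quad (K := K) i)
    rw [← le_div_iff₀ hμ]
    exact h2.trans (h1 ▸ hPnorm 1 i)
  have hC0 : 0 < C := (mul_pos hΛ hμ).trans_le hΛC
  set δ := ‖K' - K‖ with hδdef
  have hδ : 0 ≤ δ := norm_nonneg _
  -- the perturbed closed loop still contracts the value function
  have hcontract : ∀ n i x, Λ / 2 * euclNorm x ^ 2 + x ⬝ᵥ (S.backward K' (P n) i *ᵥ x) ≤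
      x ⬝ᵥ (P (n + 1) i *ᵥ x) := by
    intro n i x
    -- Here `l` is the norm of the closed loop itself, as in the radius condition; the Lipschitz
    -- constant uses the cruder `‖A‖ + ‖B‖κ`.
    have h1 := (abs_le.mp (S.abs_backward_quad_sub_le (K := K) (K' := K') (hPpos n) (hPnorm n) i x
      (euclNorm_mulVec_le _ x))).2
    have h2 := S.lambdaMin_mul_le_stageMatrix_quad (K := K) i x
    have hb : 0 ≤ ‖S.B i‖ * δ := by positivity
    have hl : 0 ≤ ‖S.closedLoop K i‖ := norm_nonneg _
    have h3 : ‖S.B i‖ * (‖S.closedLoop K i‖ + 1) ≤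
        ∑ i, ‖S.B i‖ * (‖S.A i - S.B i * K i‖ + 1) :=
      Finset.single_le_sum (f := fun i => ‖S.B i‖ * (‖S.A i - S.B i * K i‖ + 1))
        (fun _ _ => by positivity) (Finset.mem_univ i)
    have h4 : 4 * C * ((‖S.B i‖ * δ) * (‖S.closedLoop K i‖ + 1)) ≤ Λ * μ :=
      calc 4 * C * ((‖S.B i‖ * δ) * (‖S.closedLoop K i‖ + 1))
          = δ * (4 * C * (‖S.B i‖ * (‖S.closedLoop K i‖ + 1))) := by ring
        _ ≤ δ * (4 * C * ∑ i, ‖S.B i‖ * (‖S.A i - S.B i * K i‖ + 1)) := by gcongr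
        _ ≤ Λ * μ := hradius
    have h5 : C / μ * (2 * ‖S.closedLoop K i‖ * (‖S.B i‖ * δ) + (‖S.B i‖ * δ) ^ 2) ≤ Λ / 2 := by
      generalize ‖S.B i‖ * δ = e at hb h4
      generalize ‖S.closedLoop K i‖ = l at hl h4
      -- From `h4` and `Λμ ≤ C`. Then `e² ≤ 2e`, so `C (2le + e²) ≤ 2C e(l + 1) ≤ Λμ/2`, which is
      -- where the 4 in the radius is used.
      have he : e ≤ 2 := by
        have : C * e ≤ C * (e * (l + 1)) := by
          have := mul_nonneg hb hl
          gcongr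
          linarith
        refine le_of_mul_le_mul_left ?_ hC0
        linarith
      have : C * e ^ 2 ≤ C * (2 * e) := by
        rw [sq]
        gcongr
      rw [div_mul_eq_mul_div, div_le_iff₀ hμ]
      linarith
    have h6 := mul_le_mul_of_nonneg_right h5 (sq_nonneg (euclNorm x))
    have h7 : x ⬝ᵥ (P (n + 1) i *ᵥ x) =
        x ⬝ᵥ (S.stageMatrix K i *ᵥ x) + x ⬝ᵥ (S.backward K (P n) i *ᵥ x) := by
      rw [hP, MJLS.valueIter_succ, Pi.add_apply, Matrix.add_mulVec, dotProduct_add]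
    rw [h7]
    linarith
  have henergy : ∀ n, S.meanQuad Pr x₀ (S.valueIter K' 1 n) ≤ 2 * (C / Λ) := by
    intro n
    have h1 := hS.meanQuad_mono (MJLS.smul_valueIter_one_le
      (fun i x => (hPpos 0 i).quad_nonneg x) hcontract n)
    rw [MJLS.meanQuad_smul] at h1
    have h2 := h1.trans (hJP n)
    rw [← mul_div_assoc, le_div_iff₀ hΛ]
    linarith
  set κ := ∑ i, ‖K i‖
  set p := C / Λ * ‖S.Q‖ / μ with hp
  have hp0 : 0 ≤ p := by positivity
  have hCp : C / μ ≤ p := by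
    rw [hp]
    gcongr
    rw [div_mul_eq_mul_div, le_div_iff₀ hΛ]
    gcongr
  set c := (3 * (‖S.R‖ + ‖S.B‖ ^ 2 * p) * κ + 2 * ‖S.A‖ * ‖S.B‖ * p) * δ with hc
  have hκ : 0 ≤ κ := Finset.sum_nonneg fun _ _ => norm_nonneg _
  have hc0 : 0 ≤ c := by positivity
  -- Uniform in the horizon: `ε = -1` bounds the cost of `K'` from above, which also gives
  -- finiteness, and `ε = 1` bounds it from below.
  have hbound : ∀ ε : ℝ, |ε| = 1 → ∀ n, -(2 * (C / Λ) * c) ≤ ε *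
      (S.meanQuad Pr x₀ (S.valueIter K' (S.stageMatrix K') n) - S.meanQuad Pr x₀ (P n)) := by
    intro ε hε n
    have h1 := hS.meanQuad_mono (S.neg_smul_valueIter_one_le_of_step (K := K) (K' := K')
      (fun n i x => S.abs_stage_add_backward_sub_le (hPpos n) hp0
        (fun i => (hPnorm n i).trans hCp) hcap i x) ε hε n)
    have h2 : S.meanQuad Pr x₀ (S.valueIter K' (S.stageMatrix K') n) =
        S.meanQuad Pr x₀ (S.valueIter K' (S.stageMatrix K') n - P n) +
          S.meanQuad Pr x₀ (P n) := by
      rw [← hS.meanQuad_add, sub_add_cancel]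
    rw [MJLS.meanQuad_smul, MJLS.meanQuad_smul] at h1
    have h3 := mul_le_mul_of_nonneg_left (henergy n) hc0
    rw [h2, add_sub_cancel_right]
    linarith
  have hcDiff : cDiff ‖S.A‖ ‖S.B‖ ‖S.Q‖ ‖S.R‖ κ (C / Λ) μ * δ = 2 * (C / Λ) * c := by
    rw [cDiff, hc]
    ring
  rw [hcDiff]
  have hcost : S.cost Pr x₀ ω K' ≤ ENNReal.ofReal (C + 2 * (C / Λ) * c) := by
    refine hS.cost_le fun n => ?_
    have := hbound (-1) (by simp) n
    have := hJP n
    linarith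
  have hfin : S.cost Pr x₀ ω K' ≠ ⊤ := ne_top_of_le_ne_top ENNReal.ofReal_ne_top hcost
  refine ⟨hfin, abs_sub_le_iff.mpr ⟨?_, ?_⟩⟩
  · have := ENNReal.toReal_le_of_le_ofReal (by positivity) hcost
    linarith
  · have : C ≤ (S.cost Pr x₀ ω K').toReal + 2 * (C / Λ) * c := by
      refine ENNReal.toReal_le_of_le_ofReal (by positivity) (hS.cost_le fun n => ?_)
      have := hbound 1 (by simp) n
      have := hS.meanQuad_valueIter_le_cost hfin n
      linarith
    linarith
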